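/- A \emph{compact ordered space} is a compact topological space $X$ equipped with a partial order that is a closed subset of $X \times X$; $\mathsf{CompOrd}$ is the category of compact ordered spaces and order-preserving continuous maps. A \emph{Priestley space} is a compact space with a partial order such that, whenever $x \not\leq y$, some clopen up-set contains $x$ but not $y$; Priestley spaces are compact ordered spaces, and $\mathsf{Pries}$ denotes the full subcategory of $\mathsf{CompOrd}$ that they define. A category is \emph{finitely accessible} if it has directed colimits and has a set $S$ of finitely presentable objects (objects $A$ such that $\hom(A,-)$ preserves directed colimits) such that every object is a directed colimit of objects in $S$. A \emph{variety} (resp.\ \emph{quasivariety}) \emph{of finitary algebras} is a class of algebras in a signature consisting of operations of finite arity that is presented by a class of equations (resp.\ of implications $\bigwedge_{i \in I}(u_i = v_i) \Rightarrow u_0 = v_0$ with $I$ a possibly infinite set) and that has a free algebra over every set; it is regarded as a category with all homomorphisms as morphisms. Let $\mathsf{F}$ be a full subcategory of $\mathsf{CompOrd}$ containing all Priestley spaces. \begin{enumerate} \item If $\mathsf{F}^{\mathrm{op}}$ is finitely accessible, then $\mathsf{F} = \mathsf{Pries}$. \item If $\mathsf{F}^{\mathrm{op}}$ is equivalent to a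 variety or a quasivariety of finitary algebras, then $\mathsf{F} = \mathsf{Pries}$. \end{enumerate} In particular, $\mathsf{CompOrd}$ is not dually equivalent to any finitely accessible category, nor to any variety or quasivariety of finitary algebras. -/

import Mathlib

open CategoryTheory

universe u v₁ v₂ w₁ w₂

/-- A compact ordered space: a compact topological space equipped with a partial order
that is closed in the product topology. -/
structure CompOrd : Type (u + 1) where
  /-- the underlying set -/
  carrier : Type u
  [top : TopologicalSpace carrier]
  [ord : PartialOrder carrier]
  [compact : CompactSpace carrier]
  [closed : OrderClosedTopology carrier]

namespace CompOrd

instance : CoeSort CompOrd.{u} (Type u) := ⟨CompOrd.carrier⟩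

attribute [instance] CompOrd.top CompOrd.ord CompOrd.compact CompOrd.closed

/-- The category of compact ordered spaces and order-preserving continuous maps. -/
instance : Category CompOrd.{u} where
  Hom X Y := X →Co Y
  id X := ContinuousOrderHom.id X
  comp f g := g.comp f

instance : ConcreteCategory CompOrd.{u} (fun X Y => X →Co Y) where
  hom f := f
  ofHom f := f

end CompOrd

/-- Priestley spaces, as a full subcategory of `CompOrd`: whenever `x ≰ y`, some clopen up-set
contains `x` but not `y` (compactness is part of `CompOrd`). -/
def Pries : ObjectProperty CompOrd.{u} := fun X => PriestleySpace X

/-! ### Finitary algebras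

A signature of finitary operations is a first-order language `L` without relation symbols
(`L.IsAlgebraic`): it has, for each natural number `n`, a collection of `n`-ary operation symbols.
The collection may lie in any universe, so that large signatures are allowed. -/

/-- A finitary algebra in the signature `L`. The underlying set may be empty. -/
structure FinAlg (L : FirstOrder.Language.{w₁, w₂}) where
  /-- the underlying set -/
  carrier : Type u
  [str : L.Structure carrier]

namespace FinAlg

variable {L : FirstOrder.Language.{w₁, w₂}}

instance : CoeSort (FinAlg.{u} L) (Type u) := ⟨FinAlg.carrier⟩

attribute [instance] FinAlg.str

/-- The category of `L`-algebras and homomorphisms. -/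
instance : Category (FinAlg.{u} L) where
  Hom A B := L.Hom A B
  id A := FirstOrder.Language.Hom.id L A
  comp f g := g.comp f

instance : ConcreteCategory (FinAlg.{u} L) (fun A B => L.Hom A B) where
  hom f := f
  ofHom f := f

end FinAlg

/-- An equation between two terms over a set of variables. -/
structure AlgEquation (L : FirstOrder.Language.{w₁, w₂}) where
  /-- the set of variables -/
  Var : Type u
  /-- the left-hand side -/
  lhs : L.Term Var
  /-- the right-hand side -/
  rhs : L.Term Var

/-- The universally quantified equation holds in the algebra `A`. -/
def AlgEquation.Holds {L : FirstOrder.Language.{w₁, w₂}} (φ : AlgEquation.{u} L)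
    (A : FinAlg.{u} L) : Prop :=
  ∀ v : φ.Var → A, φ.lhs.realize v = φ.rhs.realize v

/-- An implication `⋀_{i ∈ I} (uᵢ = vᵢ) ⟹ (u₀ = v₀)` between equations of terms over a
set of variables, where `I` is a possibly infinite set. -/
structure AlgImplication (L : FirstOrder.Language.{w₁, w₂}) where
  /-- the set of variables -/
  Var : Type u
  /-- the set indexing the premises -/
  I : Type u
  /-- the left-hand sides of the premises -/
  premLhs : I → L.Term Var
  /-- the right-hand sides of the premises -/
  premRhs : I → L.Term Var
  /-- the left-hand side of the conclusion -/
  lhs : L.Term Var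
  /-- the right-hand side of the conclusion -/
  rhs : L.Term Var

/-- The universally quantified implication holds in the algebra `A`. -/
def AlgImplication.Holds {L : FirstOrder.Language.{w₁, w₂}} (φ : AlgImplication.{u} L)
    (A : FinAlg.{u} L) : Prop :=
  ∀ v : φ.Var → A, (∀ i, (φ.premLhs i).realize v = (φ.premRhs i).realize v) →
    φ.lhs.realize v = φ.rhs.realize v

/-- The class `K` of algebras has a free algebra, belonging to `K`, over every set. -/
def HasFreeAlgebras {L : FirstOrder.Language.{w₁, w₂}} (K : ObjectProperty (FinAlg.{u} L)) :
    Prop :=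
  ∀ κ : Type u, ∃ A : FinAlg.{u} L, K A ∧ ∃ ι : κ → A,
    ∀ B : FinAlg.{u} L, K B → ∀ f : κ → B, ∃! g : A ⟶ B, ∀ x, g (ι x) = f x

/-- A variety of `L`-algebras: a class of algebras that is presented by a class of equations
and has free algebras. -/
def IsVariety {L : FirstOrder.Language.{w₁, w₂}} (K : ObjectProperty (FinAlg.{u} L)) : Prop :=
  (∃ S : Set (AlgEquation.{u} L), ∀ A, K A ↔ ∀ φ ∈ S, φ.Holds A) ∧ HasFreeAlgebras K

/-- A quasivariety of `L`-algebras: a class of algebras that is presented by a class of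
implications and has free algebras. -/
def IsQuasivariety {L : FirstOrder.Language.{w₁, w₂}} (K : ObjectProperty (FinAlg.{u} L)) :
    Prop :=
  (∃ S : Set (AlgImplication.{u} L), ∀ A, K A ↔ ∀ φ ∈ S, φ.Holds A) ∧ HasFreeAlgebras K

/-! Call a space A good if, in `F.FullSubcategoryᵒᵖ`, every map from A to a filtered colimit factors
through a stage: half of finite presentability, and invariant under equivalence. Good spaces are
finite: A is a continuous image of the Stone space of ultrafilters on A, which is a cofiltered limit
in F of finite discrete spaces, so the surjection factors through one of these
(`finite_of_liftsToFilteredColimits`). Good objects detect lifts along monomorphisms, both in a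
finitely accessible category and in a (quasi)variety. Now let x ≰ y in X. If every map f to a good
space from the generating class had f x ≤ f y, each composite of the pair (x, y) with such an f
would extend from the two-point antichain to the chain; detection would extend the pair itself,
giving x ≤ y. Hence some f to a finite poset has f x ≰ f y, and the preimage of the up-set of f x is
the required clopen up-set (`eq_pries_of_generator`). -/

open Limits

/-! ### Test objects, and a space that is not Priestley. -/

namespace CompOrd

/-- A compact Hausdorff space equipped with the discrete order. -/
def discrete (T : Type u) [TopologicalSpace T] [CompactSpace T] [T2Space T] : CompOrd.{u} :=
  letI : PartialOrder T :=
    { le := Eq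
      le_refl := fun _ => rfl
      le_trans := fun _ _ _ => Eq.trans
      le_antisymm := fun _ _ h _ => h }
  { carrier := T
    closed := ⟨isClosed_diagonal⟩ }

/-- A continuous map from a compact Hausdorff space, as a morphism from the corresponding
discretely ordered space. -/
def discreteLift {T : Type u} [TopologicalSpace T] [CompactSpace T] [T2Space T] {X : CompOrd.{u}}
    (f : T → X) (hf : Continuous f) : discrete T ⟶ X :=
  { toFun := f
    monotone' := fun a b h => by
      have h' : a = b := h
      rw [h']
    continuous_toFun := hf : discrete T →Co X }

/-- The two-element chain. -/
def two : CompOrd.{u} :=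
  haveI : OrderClosedTopology (ULift.{u} Bool) := ⟨isClosed_discrete _⟩
  { carrier := ULift.{u} Bool }

/-- The morphism from the two-element chain that picks out a pair `x ≤ y`. -/
def twoLift {X : CompOrd.{u}} {x y : X} (h : x ≤ y) : two ⟶ X :=
  { toFun := fun b : ULift.{u} Bool => bif b.down then y else x
    monotone' := by
      rintro ⟨_ | _⟩ ⟨_ | _⟩ hab
      · exact le_rfl
      · exact h
      · exact absurd (show true ≤ false from hab) (by decide)
      · exact le_rfl
    continuous_toFun := continuous_of_discreteTopology (α := ULift.{u} Bool) : two →Co X }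

/-- The morphism that picks out a pair of points. -/
def pair {X : CompOrd.{u}} (x y : X) : discrete (ULift.{u} Bool) ⟶ X :=
  discreteLift (fun b : ULift.{u} Bool => bif b.down then y else x)
    continuous_of_discreteTopology

/-- The identity of the two-element set, from the discrete order to the chain. -/
def discreteToTwo : discrete (ULift.{u} Bool) ⟶ two.{u} :=
  discreteLift (X := two) (fun b : ULift.{u} Bool => b) continuous_id

theorem pries_of_finite (X : CompOrd.{u}) [Finite X] : Pries X :=
  haveI : DiscreteTopology X := inferInstance
  ⟨fun {x _} h => ⟨Set.Ici x, isClopen_discrete _, isUpperSet_Ici x, le_rfl, h⟩⟩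

theorem pries_two : Pries two.{u} :=
  haveI : Finite two.{u} := inferInstanceAs (Finite (ULift.{u} Bool))
  pries_of_finite _

theorem pries_discrete (T : Type u) [TopologicalSpace T] [CompactSpace T] [T2Space T]
    [TotallyDisconnectedSpace T] : Pries (discrete T) := by
  refine ⟨fun {x y} h => ?_⟩
  obtain ⟨U, hU, hx, hy⟩ := exists_isClopen_of_totally_separated (α := T) (i := x) (j := y) h
  refine ⟨U, hU, fun a b hab ha => ?_, hx, hy⟩
  have hab' : a = b := hab
  exact hab' ▸ ha

/-- The unit interval is connected, so no clopen set separates 1 from 0. -/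
theorem exists_not_pries : ∃ X : CompOrd.{u}, ¬ Pries X := by
  have : OrderClosedTopology (ULift.{u} unitInterval) :=
    ⟨isClosed_le (f := fun p : ULift.{u} unitInterval × ULift.{u} unitInterval => p.1.down)
      (g := fun p => p.2.down) (by fun_prop) (by fun_prop)⟩
  refine ⟨⟨ULift.{u} unitInterval⟩, fun h => ?_⟩
  have h' : PriestleySpace (ULift.{u} unitInterval) := h
  obtain ⟨U, hU, -, h1, h0⟩ := h'.priestley (x := ⟨1⟩) (y := ⟨0⟩)
    (fun h : (1 : unitInterval) ≤ 0 => absurd h (by simp))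
  have hV : IsClopen (ULift.up ⁻¹' U : Set unitInterval) := hU.preimage continuous_uliftUp
  rcases isClopen_iff.1 hV with hV | hV
  · exact (Set.mem_empty_iff_false _).1 (hV ▸ (show (1 : unitInterval) ∈ ULift.up ⁻¹' U from h1))
  · exact h0 (show (0 : unitInterval) ∈ ULift.up ⁻¹' U from hV ▸ Set.mem_univ _)

/-! ### Stone spaces as cofiltered limits of finite discrete spaces. -/

section Limit

variable {F : ObjectProperty CompOrd.{u}} (hF : Pries ≤ F) (T : Type u) [TopologicalSpace T]
  [CompactSpace T] [T2Space T] [TotallyDisconnectedSpace T]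

/-- The diagram of the finite discrete quotients of a Stone space, in a full subcategory of
`CompOrd` that contains the Priestley spaces. -/
def quotientDiagram : DiscreteQuotient T ⥤ F.FullSubcategory where
  obj S := ⟨discrete S, hF _ (pries_discrete S)⟩
  map {S S'} h := ObjectProperty.homMk
    (discreteLift (X := discrete S') (DiscreteQuotient.ofLE h.le)
      (DiscreteQuotient.ofLE_continuous h.le))
  map_id S := by
    ext : 1
    refine ContinuousOrderHom.ext fun x => ?_
    exact DiscreteQuotient.ofLE_refl_apply x
  map_comp {S S' S''} f g := by
    ext : 1
    refine ContinuousOrderHom.ext fun x => ?_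
    exact (DiscreteQuotient.ofLE_ofLE f.le g.le x).symm

/-- A Stone space as a cone over the diagram of its finite discrete quotients. -/
def quotientCone : Cone (quotientDiagram hF T) where
  pt := ⟨discrete T, hF _ (pries_discrete T)⟩
  π :=
    { app := fun S => ObjectProperty.homMk
        (discreteLift (X := discrete S) S.proj S.proj_continuous)
      naturality := fun S S' f => by
        ext : 1
        refine ContinuousOrderHom.ext fun x => ?_
        exact (DiscreteQuotient.ofLE_proj f.le x).symm }

theorem exists_lift_quotientCone (s : Cone (quotientDiagram hF T)) :
    ∃ l : s.pt ⟶ (quotientCone hF T).pt, ∀ S, l ≫ (quotientCone hF T).π.app S = s.π.app S := by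
  have key (x : s.pt.obj) : ∃ t : T, ∀ S : DiscreteQuotient T,
      S.proj t = (s.π.app S).hom x :=
    DiscreteQuotient.exists_of_compat (fun S => (s.π.app S).hom x) fun A B h =>
      (congrArg (fun k => k.hom x) (s.w (homOfLE h)) :)
  choose l hl using key
  have hinj {a b : T} (h : ∀ S : DiscreteQuotient T, S.proj a = S.proj b) : a = b :=
    DiscreteQuotient.eq_of_forall_proj_eq h
  have hcont : Continuous l := by
    refine continuous_iff_continuousAt.2 fun x => ?_
    refine (nhds_basis_clopen (l x)).tendsto_right_iff.2 fun U hU => ?_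
    -- The quotient whose classes are `U` and its complement.
    let S := DiscreteQuotient.ofIsClopen hU.2
    have hopen : IsOpen ((fun x => ((s.π.app S).hom x : S)) ⁻¹' {S.proj (l x)}) :=
      (isOpen_discrete (α := S) _).preimage
        (s.π.app S).hom.continuous_toFun
    filter_upwards [hopen.mem_nhds (hl x S).symm] with y hy
    have hy' : S.proj (l y) = S.proj (l x) := (hl y S).trans hy
    have := Quotient.exact hy'
    exact (show l y ∈ U ↔ l x ∈ U from this).2 hU.1
  refine ⟨ObjectProperty.homMk
    ({ toFun := l
       monotone' := fun a b hab => hinj fun S => ?_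
       continuous_toFun := hcont } : s.pt.obj →Co discrete T), fun S => ?_⟩
  -- The order on `discrete S` is equality, so monotonicity of the leg at `S` is the required
  -- equation.
  · rw [hl, hl]
    exact (s.π.app S).hom.monotone' hab
  · ext : 1
    exact ContinuousOrderHom.ext fun x => hl x S

/-- A Stone space is the limit of its finite discrete quotients, in every full subcategory of
`CompOrd` that contains the Priestley spaces. -/
noncomputable def quotientConeIsLimit : IsLimit (quotientCone hF T) where
  lift s := (exists_lift_quotientCone hF T s).choose
  fac s := (exists_lift_quotientCone hF T s).choose_spec
  uniq s m hm := by
    ext : 1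
    refine ContinuousOrderHom.ext fun x => ?_
    refine DiscreteQuotient.eq_of_forall_proj_eq (X := T) fun S => ?_
    have h := (hm S).trans ((exists_lift_quotientCone hF T s).choose_spec S).symm
    exact (congrArg (fun k => k.hom x) h :)

end Limit

end CompOrd

/-! ### Detecting lifts by objects that lift to filtered colimits. -/

namespace CategoryTheory

variable {C : Type v₁} [Category.{v₂} C]

/-- Every morphism from `G` to a small filtered colimit factors through a stage of the colimit. -/
def LiftsToFilteredColimits (G : C) : Prop :=
  ∀ ⦃J : Type u⦄ [SmallCategory J] [IsFiltered J] ⦃D : J ⥤ C⦄ ⦃c : Cocone D⦄, IsColimit c →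
    ∀ f : G ⟶ c.pt, ∃ (j : J) (p : G ⟶ D.obj j), p ≫ c.ι.app j = f

/-- A morphism `φ` factors through a monomorphism `ψ` as soon as its composites with all morphisms
from objects satisfying `P` do. -/
def ObjectProperty.DetectsLifts (P : ObjectProperty C) : Prop :=
  ∀ ⦃A B D : C⦄ (φ : A ⟶ D) (ψ : B ⟶ D) [Mono ψ],
    (∀ G, P G → ∀ p : G ⟶ A, ∃ q : G ⟶ B, q ≫ ψ = p ≫ φ) → ∃ χ : A ⟶ B, χ ≫ ψ = φ

theorem LiftsToFilteredColimits.inverse_obj {C' : Type w₁} [Category.{w₂} C'] (e : C' ≌ C) {G : C}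
    (hG : LiftsToFilteredColimits.{u} G) : LiftsToFilteredColimits.{u} (e.inverse.obj G) := by
  intro J _ _ D c hc f
  let adj := e.symm.toAdjunction
  obtain ⟨j, p, hp⟩ := hG (isColimitOfPreserves e.functor hc) (adj.homEquiv _ _ f)
  refine ⟨j, (adj.homEquiv _ _).symm p, ?_⟩
  have h := adj.homEquiv_naturality_right_symm p (c.ι.app j)
  rw [← h]
  exact (Equiv.symm_apply_eq _).2 hp

theorem exists_generator_of_isFinitelyAccessibleCategory [IsFinitelyAccessibleCategory.{u} C] :
    ∃ P : ObjectProperty C, (∀ G, P G → LiftsToFilteredColimits.{u} G) ∧ P.DetectsLifts := by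
  have := Cardinal.fact_isRegular_aleph0.{u}
  obtain ⟨P, _, hP⟩ := HasCardinalFilteredGenerator.exists_generator C Cardinal.aleph0.{u}
  refine ⟨P, fun G hG J _ _ D c hc f => ?_, fun A B D φ ψ _ h => ?_⟩
  · have : IsCardinalPresentable G Cardinal.aleph0.{u} := hP.le_isCardinalPresentable _ hG
    have : IsCardinalFiltered J Cardinal.aleph0.{u} :=
      (isCardinalFiltered_aleph0_iff.{u} J).2 inferInstance
    exact IsCardinalPresentable.exists_hom_of_isColimit Cardinal.aleph0.{u} hc f
  · obtain ⟨J, _, _, ⟨p⟩⟩ := hP.exists_colimitsOfShape A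
    choose q hq using fun j => h _ (p.prop_diag_obj j) (p.ι.app j)
    let s : Cocone p.diag :=
      { pt := B
        ι :=
          { app := q
            -- The chosen lifts are compatible because `ψ` is mono.
            naturality := fun i j f => by
              rw [← cancel_mono ψ]
              simp [hq] } }
    refine ⟨p.isColimit.desc s, p.isColimit.hom_ext fun j => ?_⟩
    rw [p.isColimit.fac_assoc]
    exact hq j

end CategoryTheory

/-! ### Good spaces are finite, and they force the Priestley property. -/

namespace CompOrd

variable {F : ObjectProperty CompOrd.{u}} (hF : Pries ≤ F)

include hF

/-- A space whose dual object lifts to filtered colimits is a quotient of a finite space, as every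
morphism to it from a Stone space factors through a finite quotient. -/
theorem finite_of_liftsToFilteredColimits {A : F.FullSubcategoryᵒᵖ}
    (hA : LiftsToFilteredColimits.{u} A) : Finite A.unop.obj := by
  let T := Ultrafilter A.unop.obj
  -- Sends each ultrafilter to its limit; principal ultrafilters make it surjective.
  let f : T → A.unop.obj := Ultrafilter.extend id
  let g : (quotientCone hF T).pt ⟶ A.unop :=
    ObjectProperty.homMk (discreteLift f (continuous_ultrafilter_extend id))
  obtain ⟨S, p, hp⟩ := hA (quotientConeIsLimit hF T).op g.op
  have hp' (t : T) : p.unop.hom (S.unop.proj t) = f t :=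
    (congrArg (fun k => k.unop.hom t) hp :)
  refine Finite.of_surjective (α := S.unop) (fun s => p.unop.hom s) fun a => ?_
  exact ⟨S.unop.proj (pure a), (hp' _).trans (ultrafilter_extend_pure id a)⟩

/-- If the dual of a full subcategory containing the Priestley spaces is equivalent to a category
in which lifts are detected by objects that lift to filtered colimits, then it consists of
Priestley spaces. -/
theorem eq_pries_of_generator {C : Type v₁} [Category.{v₂} C] (e : F.FullSubcategoryᵒᵖ ≌ C)
    (P : ObjectProperty C) (hP : ∀ G, P G → LiftsToFilteredColimits.{u} G)
    (hP' : P.DetectsLifts) : F = Pries := by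
  refine le_antisymm (fun X hX => ⟨fun {x y} hxy => ?_⟩) hF
  let X' : F.FullSubcategory := ⟨X, hX⟩
  let D : F.FullSubcategory := ⟨discrete (ULift.{u} Bool), hF _ (pries_discrete _)⟩
  let I : F.FullSubcategory := ⟨two, hF _ pries_two⟩
  let k : D ⟶ X' := ObjectProperty.homMk (pair x y)
  let j : D ⟶ I := ObjectProperty.homMk discreteToTwo
  -- `j` is bijective on points though not invertible; dually it becomes the monomorphism that
  -- `DetectsLifts` needs.
  have : Epi j := ⟨fun g h hgh => by
    ext : 1
    exact ContinuousOrderHom.ext fun b => (congrArg (fun l => l.hom b) hgh :)⟩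
  let adj := e.symm.toAdjunction
  by_cases H : ∀ G, P G → ∀ f : X' ⟶ (e.inverse.obj G).unop, f.hom x ≤ f.hom y
  · obtain ⟨χ, hχ⟩ := hP' (e.functor.map k.op) (e.functor.map j.op) fun G hG p => by
      let f := (adj.homEquiv _ _).symm p
      let h : I ⟶ (e.inverse.obj G).unop := ObjectProperty.homMk (twoLift (H G hG f.unop))
      have hh : h.op ≫ j.op = f ≫ k.op := by
        refine Quiver.Hom.unop_inj ?_
        ext : 1
        refine ContinuousOrderHom.ext ?_
        rintro ⟨_ | _⟩ <;> rfl
      refine ⟨adj.homEquiv _ _ h.op, ?_⟩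
      have h1 := adj.homEquiv_naturality_right h.op j.op
      have h2 := adj.homEquiv_naturality_right f k.op
      rw [hh, h2] at h1
      exact h1.symm.trans (by simp [f])
    have hl : (e.functor.preimage χ) ≫ j.op = k.op :=
      e.functor.map_injective (by rw [Functor.map_comp, Functor.map_preimage, hχ])
    let l : I ⟶ X' := (e.functor.preimage χ).unop
    have hl' (b : ULift.{u} Bool) : l.hom b = pair x y b :=
      (congrArg (fun m => m.unop.hom b) hl :)
    have hle : l.hom (⟨false⟩ : ULift.{u} Bool) ≤ l.hom (⟨true⟩ : ULift.{u} Bool) :=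
      l.hom.monotone' (show false ≤ true by decide)
    rw [hl', hl'] at hle
    exact absurd hle hxy
  · push Not at H
    obtain ⟨G, hG, f, hf⟩ := H
    have : Finite (e.inverse.obj G).unop.obj :=
      finite_of_liftsToFilteredColimits hF ((hP G hG).inverse_obj e)
    have : DiscreteTopology (e.inverse.obj G).unop.obj := inferInstance
    refine ⟨f.hom ⁻¹' Set.Ici (f.hom x), (isClopen_discrete _).preimage f.hom.continuous_toFun,
      (isUpperSet_Ici _).preimage f.hom.monotone', le_rfl, hf⟩

end CompOrd

/-! ### The free algebra on one generator in a variety or quasivariety. -/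

section Algebras

open FirstOrder FirstOrder.Language

variable {L : FirstOrder.Language.{w₁, w₂}} {K : ObjectProperty (FinAlg.{u} L)}

theorem prop_of_injective (hK : IsVariety K ∨ IsQuasivariety K) {A B : FinAlg.{u} L} (f : B ⟶ A)
    (hf : Function.Injective f) (hA : K A) : K B := by
  let g : L.Hom B A := f
  have hg : Function.Injective g := hf
  have hr {α : Type u} (t : L.Term α) (v : α → B) : t.realize (g ∘ v) = g (t.realize v) :=
    HomClass.realize_term g
  rcases hK with ⟨⟨S, hS⟩, -⟩ | ⟨⟨S, hS⟩, -⟩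
  · rw [hS] at hA ⊢
    intro φ hφ v
    apply hg
    rw [← hr, ← hr]
    exact hA φ hφ (g ∘ v)
  · rw [hS] at hA ⊢
    intro φ hφ v hv
    apply hg
    rw [← hr, ← hr]
    refine hA φ hφ (g ∘ v) fun i => ?_
    rw [hr, hr, hv i]

/-- In a class closed under subalgebras, a filtered colimit is the union of the images of the
stages. -/
theorem exists_of_mem_colimit [L.IsAlgebraic]
    (hK : ∀ ⦃A B : FinAlg.{u} L⦄ (f : B ⟶ A), Function.Injective f → K A → K B)
    {J : Type v₁} [Category.{v₂} J] [IsFiltered J] {D : J ⥤ K.FullSubcategory} {c : Cocone D}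
    (hc : IsColimit c) (a : c.pt.obj) : ∃ (j : J) (b : (D.obj j).obj), (c.ι.app j).hom b = a := by
  let ι (j : J) : L.Hom (D.obj j).obj c.pt.obj := (c.ι.app j).hom
  have hι {i j : J} (f : i ⟶ j) (b) : ι j ((D.map f).hom b) = ι i b :=
    (congrArg (fun k => k.hom b) (c.w f) :)
  let S : L.Substructure c.pt.obj :=
    { carrier := {a | ∃ j b, ι j b = a}
      fun_mem := fun {n} f x hx => by
        classical
        choose j b hb using hx
        -- Finite arity is essential here: finitely many arguments come from a common stage.
        obtain ⟨k, hk⟩ := IsFiltered.sup_objs_exists (Finset.univ.image j)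
        have g (i : Fin n) : j i ⟶ k :=
          (hk (Finset.mem_image_of_mem j (Finset.mem_univ i))).some
        refine ⟨k, Structure.funMap f fun i => (D.map (g i)).hom (b i), ?_⟩
        rw [(ι k).map_fun]
        congr 1
        funext i
        exact (hι (g i) (b i)).trans (hb i) }
  let i : (⟨S⟩ : FinAlg.{u} L) ⟶ c.pt.obj := S.subtype.toHom
  let U : K.FullSubcategory := ⟨⟨S⟩, hK i Subtype.val_injective c.pt.property⟩
  let s : Cocone D :=
    { pt := U
      ι :=
        { app := fun j => ObjectProperty.homMk
            ({ toFun := fun b => ⟨ι j b, j, b, rfl⟩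
               map_fun' := fun f x => Subtype.ext ((ι j).map_fun f x)
               map_rel' := fun r => isEmptyElim r } : L.Hom (D.obj j).obj S)
          naturality := fun i j f => by
            ext : 1
            exact Hom.ext fun b => Subtype.ext (hι f b) } }
  -- The inclusion of the union `S` thus has a section, so `S` is everything.
  have h : hc.desc s ≫ ObjectProperty.homMk i = 𝟙 c.pt := by
    refine hc.hom_ext fun j => ?_
    rw [hc.fac_assoc, Category.comp_id]
    rfl
  have ha : ((hc.desc s).hom a : S).1 = a := (congrArg (fun k => k.hom a) h :)
  rw [← ha]
  exact ((hc.desc s).hom a : S).2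

/-- The free algebra on one generator represents the underlying set. Lifting to filtered colimits
then means that elements come from a stage, and monomorphisms are injective, so pointwise lifts
along them are homomorphisms. -/
theorem exists_generator_of_isQuasivariety [L.IsAlgebraic] (hK : IsVariety K ∨ IsQuasivariety K) :
    ∃ P : ObjectProperty K.FullSubcategory,
      (∀ G, P G → LiftsToFilteredColimits.{u} G) ∧ P.DetectsLifts := by
  have hfree : HasFreeAlgebras K := hK.elim (·.2) (·.2)
  obtain ⟨A₁, hA₁, ι, hι⟩ := hfree PUnit.{u + 1}
  let G : K.FullSubcategory := ⟨A₁, hA₁⟩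
  let g : G.obj := ι ⟨⟩
  have hext {B : K.FullSubcategory} {f f' : G ⟶ B} (h : f.hom g = f'.hom g) : f = f' := by
    ext : 1
    exact (hι B.obj B.property fun _ => f'.hom g).unique (fun _ => h) fun _ => rfl
  have hex {B : K.FullSubcategory} (b : B.obj) : ∃ f : G ⟶ B, f.hom g = b := by
    obtain ⟨f, hf, -⟩ := hι B.obj B.property fun _ => b
    exact ⟨ObjectProperty.homMk f, hf _⟩
  refine ⟨fun X => X = G, ?_, ?_⟩
  · rintro _ rfl J _ _ D c hc f
    obtain ⟨j, b, hb⟩ := exists_of_mem_colimit (fun _ _ => prop_of_injective hK) hc (f.hom g)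
    obtain ⟨p, hp⟩ := hex b
    refine ⟨j, p, hext ?_⟩
    rw [← hb, ← hp]
    rfl
  · intro A B D φ ψ _ h
    have hψ : Function.Injective ψ.hom := fun b b' hb => by
      obtain ⟨p, rfl⟩ := hex b
      obtain ⟨p', rfl⟩ := hex b'
      have : p ≫ ψ = p' ≫ ψ := hext hb
      rw [cancel_mono] at this
      rw [this]
    have hlift (a : A.obj) : ∃ b : B.obj, ψ.hom b = φ.hom a := by
      obtain ⟨p, rfl⟩ := hex a
      obtain ⟨q, hq⟩ := h G rfl p
      exact ⟨q.hom g, (congrArg (fun k => k.hom g) hq :)⟩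
    choose χ hχ using hlift
    let φ' : L.Hom A.obj D.obj := φ.hom
    let ψ' : L.Hom B.obj D.obj := ψ.hom
    refine ⟨ObjectProperty.homMk
      ({ toFun := χ
         map_fun' := fun f x => hψ ?_
         map_rel' := fun r => isEmptyElim r } : L.Hom A.obj B.obj), ?_⟩
    · refine (hχ _).trans ((φ'.map_fun f x).trans (Eq.trans ?_ (ψ'.map_fun f (χ ∘ x)).symm))
      congr 1
      funext i
      exact (hχ (x i)).symm
    · ext : 1
      exact Hom.ext hχ

end Algebras


theorem mainTheorem3 :
    -- a full subcategory of `CompOrd` extending `Pries` with finitely accessible dual is `Pries`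
    (∀ F : ObjectProperty CompOrd.{u}, Pries ≤ F →
      IsFinitelyAccessibleCategory.{u} F.FullSubcategoryᵒᵖ → F = Pries) ∧
    -- so is one whose dual is equivalent to a variety or quasivariety of finitary algebras
    (∀ F : ObjectProperty CompOrd.{u}, Pries ≤ F →
      ∀ (L : FirstOrder.Language.{w₁, w₂}) [L.IsAlgebraic] (K : ObjectProperty (FinAlg.{u} L)),
        IsVariety K ∨ IsQuasivariety K →
          Nonempty (F.FullSubcategoryᵒᵖ ≌ K.FullSubcategory) → F = Pries) ∧
    -- `CompOrd` is not dually equivalent to any finitely accessible category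
    (∀ (C : Type v₁) [Category.{v₂} C], IsFinitelyAccessibleCategory.{u} C →
      IsEmpty (CompOrd.{u}ᵒᵖ ≌ C)) ∧
    -- `CompOrd` is not dually equivalent to any variety or quasivariety of finitary algebras
    (∀ (L : FirstOrder.Language.{w₁, w₂}) [L.IsAlgebraic] (K : ObjectProperty (FinAlg.{u} L)),
      IsVariety K ∨ IsQuasivariety K → IsEmpty (CompOrd.{u}ᵒᵖ ≌ K.FullSubcategory)) := by
  have ofEquiv (F : ObjectProperty CompOrd.{u}) (hF : Pries ≤ F) (L : FirstOrder.Language.{w₁, w₂})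
      [L.IsAlgebraic] (K : ObjectProperty (FinAlg.{u} L)) (hK : IsVariety K ∨ IsQuasivariety K)
      (e : F.FullSubcategoryᵒᵖ ≌ K.FullSubcategory) : F = Pries := by
    obtain ⟨P, hP, hP'⟩ := exists_generator_of_isQuasivariety hK
    exact CompOrd.eq_pries_of_generator hF e P hP hP'
  have top_ne : (⊤ : ObjectProperty CompOrd.{u}) ≠ Pries := fun h => by
    obtain ⟨X, hX⟩ := CompOrd.exists_not_pries.{u}
    exact hX (h ▸ trivial)
  have topEquiv := (ObjectProperty.topEquivalence CompOrd.{u}).op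
  refine ⟨fun F hF _ => ?_, fun F hF L _ K hK ⟨e⟩ => ofEquiv F hF L K hK e,
    fun C _ _ => ⟨fun e => ?_⟩,
    fun L _ K hK => ⟨fun e => top_ne (ofEquiv ⊤ le_top L K hK (topEquiv.trans e))⟩⟩
  · obtain ⟨P, hP, hP'⟩ :=
      exists_generator_of_isFinitelyAccessibleCategory.{u} (C := F.FullSubcategoryᵒᵖ)
    exact CompOrd.eq_pries_of_generator hF .refl P hP hP'
  · obtain ⟨P, hP, hP'⟩ := exists_generator_of_isFinitelyAccessibleCategory.{u} (C := C)
    exact top_ne (CompOrd.eq_pries_of_generator le_top (topEquiv.trans e) P hP hP')
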